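/- All rings are commutative with identity and all modules are unital. For a ring $A$, a complete projective resolution over $A$ is an exact complex $\mathbf P=\cdots\to P_1\to P_0\to P^0\to P^1\to\cdots$ of projective $A$-modules such that $\mathrm{Hom}_A(\mathbf P,Q)$ is exact for every projective $A$-module $Q$; an $A$-module is Gorenstein projective if it is isomorphic to $\mathrm{Im}(P_0\to P^0)$ for some such $\mathbf P$. The Gorenstein projective dimension $\mathrm{Gpd}_A(M)\in\mathbb N\cup\{\infty\}$ of an $A$-module $M$ is the least $k\ge 0$ such that there is an exact sequence $0\to G_k\to\cdots\to G_0\to M\to 0$ with all $G_j$ Gorenstein projective (and $\infty$ if there is none), and $G.\mathrm{gldim}(A)=\sup\{\mathrm{Gpd}_A(M)\mid M \text{ an } A\text{-module}\}$. Let $R$ be a ring, let $E$ be an $R$-module, and let $R\ltimes E$ be the trivial ring extension, that is, the group $R\times E$ with multiplication $(r,e)(r',e')=(rr',re'+r'e)$. Regard $R$ as an $R\ltimes E$-module via the ring map $\varepsilon:R\ltimes E\to R$, $\varepsilon(r,e)=r$. Let $n\in\mathbb N\cup\{\infty\}$. **Proposition.** Assume that $G.\mathrm{gldim}(R\ltimes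 E)<\infty$ and that $\mathrm{Tor}_i^{R\ltimes E}(M,R)=0$ for all integers $i>n$ and every $R\ltimes E$-module $M$ of finite projective dimension. Then $G.\mathrm{gldim}(R\ltimes E)\le G.\mathrm{gldim}(R)+n$. -/

import Mathlib

universe u

/-- An `R`-module `M` is Gorenstein projective if it is the image of `K⁰ ⟶ K¹` for a complete
projective resolution `K`: an exact complex `⋯ ⟶ K⁻¹ ⟶ K⁰ ⟶ K¹ ⟶ ⋯` of projective `R`-modules
such that the complex `Hom_R(K, Q)` is exact for every projective `R`-module `Q`. -/
def IsGorensteinProjective (R : Type u) [Ring R] (M : ModuleCat.{u} R) : Prop :=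
  ∃ K : CochainComplex (ModuleCat.{u} R) ℤ,
    (∀ i : ℤ, Module.Projective R (K.X i)) ∧
    (∀ i j k : ℤ, i + 1 = j → j + 1 = k → Function.Exact (K.d i j).hom (K.d j k).hom) ∧
    (∀ Q : ModuleCat.{u} R, Module.Projective R Q → ∀ i j k : ℤ, i + 1 = j → j + 1 = k →
      Function.Exact (fun g : K.X k →ₗ[R] Q => g ∘ₗ (K.d j k).hom)
        (fun f : K.X j →ₗ[R] Q => f ∘ₗ (K.d i j).hom)) ∧
    Nonempty (M ≃ₗ[R] LinearMap.range (K.d 0 1).hom)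

/-- `GorensteinProjectiveDimensionLE R n M` says that there is an exact sequence
`0 ⟶ Gₙ ⟶ ⋯ ⟶ G₁ ⟶ G₀ ⟶ M ⟶ 0` of `R`-modules with all `Gᵢ` Gorenstein projective. The sequence
is given by its short exact pieces: for `n + 1`, a short exact sequence `0 ⟶ K ⟶ G₀ ⟶ M ⟶ 0`
and such a resolution of length `n` of `K`. -/
def GorensteinProjectiveDimensionLE (R : Type u) [Ring R] : ℕ → ModuleCat.{u} R → Prop
  | 0, M => IsGorensteinProjective R M
  | n + 1, M => ∃ (K G : ModuleCat.{u} R) (i : K →ₗ[R] G) (p : G →ₗ[R] M),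
      Function.Injective i ∧ Function.Exact i p ∧ Function.Surjective p ∧
      IsGorensteinProjective R G ∧ GorensteinProjectiveDimensionLE R n K

/-- The Gorenstein projective dimension `Gpd_R(M)`: the least length of a resolution of `M` by
Gorenstein projective modules, and `⊤` if there is no finite one. -/
noncomputable def gorensteinProjectiveDimension (R : Type u) [Ring R] (M : ModuleCat.{u} R) :
    ℕ∞ :=
  ⨅ (n : ℕ) (_ : GorensteinProjectiveDimensionLE R n M), (n : ℕ∞)

/-- The Gorenstein global dimension `G.gldim(R) = sup {Gpd_R(M) | M an R-module}`. -/
noncomputable def gorensteinGlobalDimension (R : Type u) [Ring R] : ℕ∞ :=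
  ⨆ M : ModuleCat.{u} R, gorensteinProjectiveDimension R M

/-- The ring `R`, as a module over the trivial extension `R ⋉ E` through the projection
`ε : R ⋉ E → R`, `ε (r, e) = r`. -/
noncomputable def baseAsModule (R E : Type u) [CommRing R] [AddCommGroup E] [Module R E]
    [Module Rᵐᵒᵖ E] [IsCentralScalar R E] : ModuleCat.{u} (TrivSqZeroExt R E) :=
  (ModuleCat.restrictScalars (TrivSqZeroExt.fstHom R R E).toRingHom).obj (ModuleCat.of R R)

/-! Write `S = R ⋉ E`, `I = ker ε` and `d = G.gldim(R)`. Then `I² = 0`, and `R → S` splits `S → R`.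
Only finite `n` and `d` need an argument.

The problem reduces to ordinary projective dimension. A module `M` with `Gpd M < ∞` embeds in a
module `W` of finite projective dimension with Gorenstein projective cokernel
(`GorensteinProjectiveDimensionLE.exists_hull`), and a bound `pd W ≤ k` gives `Gpd M ≤ k`. Since
`G.gldim(S) < ∞`, it is enough to show `pd W ≤ n + d` for every `S`-module `W` of finite projective
dimension.

Resolve `W` by projectives `Pⱼ` with syzygies `Kⱼ`. By the vanishing of Tor, `R ⊗ -` keeps `0 → Kⱼ₊₁
→ Pⱼ → Kⱼ → 0` exact for `j ≥ n`, so `R ⊗ Kₙ` has finite projective dimension over `R`. A finite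
projective dimension is at most the Gorenstein one, hence at most `d`, so `R ⊗ Kₙ₊d` is projective
over `R`. Because `I` is square-zero and Tor vanishes, projectivity lifts to `Kₙ₊d` over `S`
(`projective_of_projective_baseChange`). -/

open CategoryTheory CategoryTheory.Abelian

/-! ### Short exact sequences of modules and vanishing of Ext -/

section ShortExactSequences

variable {R : Type u} [Ring R]

/-- There is a short exact sequence `0 ⟶ A ⟶ B ⟶ C ⟶ 0` of `R`-modules. -/
def HasShortExact (A B C : ModuleCat.{u} R) : Prop :=
  ∃ (f : A →ₗ[R] B) (g : B →ₗ[R] C),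
    Function.Injective f ∧ Function.Exact f g ∧ Function.Surjective g

/-- The categorical short complex of a pair of exact linear maps. -/
abbrev moduleShortComplex {A B C : ModuleCat.{u} R} (f : A →ₗ[R] B) (g : B →ₗ[R] C)
    (h : Function.Exact f g) : ShortComplex (ModuleCat.{u} R) :=
  ShortComplex.mk (ModuleCat.ofHom f) (ModuleCat.ofHom g) (by
    ext x; exact h.apply_apply_eq_zero x)

theorem moduleShortComplex_shortExact {A B C : ModuleCat.{u} R} {f : A →ₗ[R] B} {g : B →ₗ[R] C}
    (hf : Function.Injective f) (h : Function.Exact f g) (hg : Function.Surjective g) :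
    (moduleShortComplex f g h).ShortExact where
  exact := (ShortComplex.ShortExact.moduleCat_exact_iff_function_exact _).2 h
  mono_f := (ModuleCat.mono_iff_injective _).2 hf
  epi_g := (ModuleCat.epi_iff_surjective _).2 hg

theorem HasShortExact.exists_shortExact {A B C : ModuleCat.{u} R} (h : HasShortExact A B C) :
    ∃ (f : A ⟶ B) (g : B ⟶ C) (w : f ≫ g = 0), (ShortComplex.mk f g w).ShortExact := by
  obtain ⟨f, g, hf, hfg, hg⟩ := h
  exact ⟨_, _, _, moduleShortComplex_shortExact hf hfg hg⟩

theorem HasShortExact.of_equiv {A B C A' C' : ModuleCat.{u} R} (h : HasShortExact A B C)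
    (eA : A ≃ₗ[R] A') (eC : C ≃ₗ[R] C') : HasShortExact A' B C' := by
  obtain ⟨f, g, hf, hfg, hg⟩ := h
  refine ⟨f ∘ₗ eA.symm.toLinearMap, eC.toLinearMap ∘ₗ g, ?_, ?_, ?_⟩
  · exact hf.comp eA.symm.injective
  · intro b
    constructor
    · intro hb
      obtain ⟨a, rfl⟩ := (hfg b).1 (by simpa using hb)
      exact ⟨eA a, by simp⟩
    · rintro ⟨a, rfl⟩
      simp [hfg.apply_apply_eq_zero]
  · exact eC.surjective.comp hg

theorem hasShortExact_of_surjective {B C : ModuleCat.{u} R} (g : B →ₗ[R] C)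
    (hg : Function.Surjective g) :
    HasShortExact (ModuleCat.of R (LinearMap.ker g)) B C :=
  ⟨(LinearMap.ker g).subtype, g, Subtype.val_injective,
    LinearMap.exact_subtype_ker_map g, hg⟩

theorem hasShortExact_of_injective {A B : ModuleCat.{u} R} (f : A →ₗ[R] B)
    (hf : Function.Injective f) :
    HasShortExact A B (ModuleCat.of R (B ⧸ LinearMap.range f)) :=
  ⟨f, (LinearMap.range f).mkQ, hf, LinearMap.exact_map_mkQ_range f, Submodule.mkQ_surjective _⟩

/-- Every module is a quotient of a projective module. -/
theorem exists_hasShortExact_projective (M : ModuleCat.{u} R) :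
    ∃ K P : ModuleCat.{u} R, Module.Projective R P ∧ HasShortExact K P M :=
  ⟨_, ModuleCat.of R (M →₀ R), inferInstanceAs (Module.Projective R (M →₀ R)),
    hasShortExact_of_surjective (Finsupp.linearCombination R (id : M → M))
      (Finsupp.linearCombination_id_surjective R M)⟩

/-- The pushout of a short exact sequence along an injection. -/
theorem HasShortExact.exists_pushout {A B C A' A'' : ModuleCat.{u} R} (h : HasShortExact A B C)
    (h' : HasShortExact A A' A'') :
    ∃ D : ModuleCat.{u} R, HasShortExact A' D C ∧ HasShortExact B D A'' := by
  obtain ⟨f, g, hf, hfg, hg⟩ := h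
  obtain ⟨f', g', hf', hfg', hg'⟩ := h'
  let N : Submodule R (A' × B) := LinearMap.range (f'.prod (-f))
  have hN : ∀ x : A' × B, x ∈ N ↔ ∃ a, f' a = x.1 ∧ -f a = x.2 := fun x => by
    simp [N, Prod.ext_iff]
  refine ⟨ModuleCat.of R ((A' × B) ⧸ N),
    ⟨N.mkQ ∘ₗ LinearMap.inl R A' B, N.liftQ (g ∘ₗ LinearMap.snd R A' B) ?_, ?_, ?_, ?_⟩,
    ⟨N.mkQ ∘ₗ LinearMap.inr R A' B, N.liftQ (g' ∘ₗ LinearMap.fst R A' B) ?_, ?_, ?_, ?_⟩⟩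
  · rintro _ ⟨a, rfl⟩
    simp [hfg.apply_apply_eq_zero]
  · refine (injective_iff_map_eq_zero _).2 fun x hx => ?_
    obtain ⟨a, h1, h2⟩ := (hN _).1 ((Submodule.Quotient.mk_eq_zero N).1 hx)
    have : a = 0 := hf (by simpa using h2)
    simpa [this] using h1.symm
  · intro y
    obtain ⟨⟨a', b⟩, rfl⟩ := N.mkQ_surjective y
    constructor
    · intro hy
      obtain ⟨a, rfl⟩ := (hfg b).1 hy
      -- Modulo `N`, the pair `(0, f a)` equals `(f' a, 0)`.
      refine ⟨a' + f' a, (Submodule.Quotient.eq N).2 ((hN _).2 ⟨a, ?_, ?_⟩)⟩ <;> simp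
    · rintro ⟨x, hx⟩
      rw [← hx]
      simp
  · intro c
    obtain ⟨b, rfl⟩ := hg c
    exact ⟨N.mkQ (0, b), rfl⟩
  · rintro _ ⟨a, rfl⟩
    simp [hfg'.apply_apply_eq_zero]
  · refine (injective_iff_map_eq_zero _).2 fun x hx => ?_
    obtain ⟨a, h1, h2⟩ := (hN _).1 ((Submodule.Quotient.mk_eq_zero N).1 hx)
    have : a = 0 := hf' (by simpa using h1)
    simpa [this] using h2.symm
  · intro y
    obtain ⟨⟨a', b⟩, rfl⟩ := N.mkQ_surjective y
    constructor
    · intro hy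
      obtain ⟨a, rfl⟩ := (hfg' a').1 hy
      refine ⟨b + f a, (Submodule.Quotient.eq N).2 ((hN _).2 ⟨-a, ?_, ?_⟩)⟩ <;> simp
    · rintro ⟨x, hx⟩
      rw [← hx]
      simp
  · intro c
    obtain ⟨b, rfl⟩ := hg' c
    exact ⟨N.mkQ (b, 0), rfl⟩

/-- The cokernels of two composable injections and of their composition. -/
theorem HasShortExact.exists_cokernel_comp {A B C D E : ModuleCat.{u} R}
    (h : HasShortExact A B C) (h' : HasShortExact B D E) :
    ∃ F : ModuleCat.{u} R, HasShortExact A D F ∧ HasShortExact C F E := by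
  obtain ⟨f, g, hf, hfg, hg⟩ := h
  obtain ⟨f', g', hf', hfg', hg'⟩ := h'
  refine ⟨_, hasShortExact_of_injective (f' ∘ₗ f) (hf'.comp hf), ?_⟩
  let N := LinearMap.range (f' ∘ₗ f)
  let e : (B ⧸ LinearMap.ker g) ≃ₗ[R] C := g.quotKerEquivOfSurjective hg
  have hle : LinearMap.ker g ≤ LinearMap.ker (N.mkQ ∘ₗ f') := by
    intro b hb
    obtain ⟨a, rfl⟩ := (hfg b).1 hb
    exact (Submodule.Quotient.mk_eq_zero N).2 ⟨a, rfl⟩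
  have hle' : N ≤ LinearMap.ker g' := by
    rintro _ ⟨a, rfl⟩
    exact hfg'.apply_apply_eq_zero (f a)
  refine HasShortExact.of_equiv (A := ModuleCat.of R (B ⧸ LinearMap.ker g)) (C := E)
    ⟨(LinearMap.ker g).liftQ (N.mkQ ∘ₗ f') hle, N.liftQ g' hle', ?_, ?_, ?_⟩ e (.refl R E)
  · refine (injective_iff_map_eq_zero _).2 fun x hx => ?_
    obtain ⟨b, rfl⟩ := (LinearMap.ker g).mkQ_surjective x
    obtain ⟨a, ha⟩ := (Submodule.Quotient.mk_eq_zero N).1 hx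
    refine (Submodule.Quotient.mk_eq_zero _).2 ?_
    rw [← hf' ha]
    exact hfg.apply_apply_eq_zero a
  · intro y
    obtain ⟨d, rfl⟩ := N.mkQ_surjective y
    constructor
    · intro hy
      obtain ⟨b, rfl⟩ := (hfg' d).1 hy
      exact ⟨(LinearMap.ker g).mkQ b, rfl⟩
    · rintro ⟨x, hx⟩
      obtain ⟨b, rfl⟩ := (LinearMap.ker g).mkQ_surjective x
      rw [← hx]
      exact hfg'.apply_apply_eq_zero b
  · intro c
    obtain ⟨d, rfl⟩ := hg' c
    exact ⟨N.mkQ d, rfl⟩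

/-- The kernels of two composable surjections and of their composition. -/
theorem HasShortExact.exists_kernel_comp {A B C M E : ModuleCat.{u} R}
    (h : HasShortExact A B C) (h' : HasShortExact M C E) :
    ∃ D : ModuleCat.{u} R, HasShortExact A D M ∧ HasShortExact D B E := by
  obtain ⟨f, g, hf, hfg, hg⟩ := h
  obtain ⟨f', g', hf', hfg', hg'⟩ := h'
  refine ⟨_, ?_, hasShortExact_of_surjective (g' ∘ₗ g) (hg'.comp hg)⟩
  let e : M ≃ₗ[R] LinearMap.range f' := LinearEquiv.ofInjective f' hf'
  let p : LinearMap.ker (g' ∘ₗ g) →ₗ[R] LinearMap.range f' :=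
    (g ∘ₗ Submodule.subtype _).codRestrict _ fun x => (hfg' (g x)).1 x.2
  refine HasShortExact.of_equiv (A := A) (C := ModuleCat.of R (LinearMap.range f'))
    ⟨f.codRestrict _ fun a => ?_, p, ?_, ?_, ?_⟩ (.refl R A) e.symm
  · simp [hfg.apply_apply_eq_zero]
  · exact fun a b hab => hf (congrArg Subtype.val hab)
  · rintro ⟨x, hx⟩
    constructor
    · intro h0
      obtain ⟨a, rfl⟩ := (hfg x).1 (congrArg Subtype.val h0)
      exact ⟨a, rfl⟩
    · rintro ⟨a, ha⟩
      rw [← ha]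
      exact Subtype.ext (hfg.apply_apply_eq_zero a)
  · rintro ⟨_, m, rfl⟩
    obtain ⟨b, hb⟩ := hg (f' m)
    refine ⟨⟨b, ?_⟩, Subtype.ext hb⟩
    simp [hb, hfg'.apply_apply_eq_zero]

theorem HasShortExact.subsingleton_ext_left {A B C : ModuleCat.{u} R} (h : HasShortExact A B C)
    (Y : ModuleCat.{u} R) (i : ℕ) (hB : Subsingleton (Ext B Y i))
    (hC : Subsingleton (Ext C Y (i + 1))) : Subsingleton (Ext A Y i) := by
  obtain ⟨f, g, w, hS⟩ := h.exists_shortExact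
  refine subsingleton_of_forall_eq 0 fun x => ?_
  obtain ⟨y, rfl⟩ := Ext.contravariant_sequence_exact₁ hS _ x (add_comm 1 i)
    (Subsingleton.elim _ _)
  rw [Subsingleton.elim y 0, Ext.comp_zero]

theorem HasShortExact.subsingleton_ext_middle {A B C : ModuleCat.{u} R} (h : HasShortExact A B C)
    (Y : ModuleCat.{u} R) (i : ℕ) (hA : Subsingleton (Ext A Y i))
    (hC : Subsingleton (Ext C Y i)) : Subsingleton (Ext B Y i) := by
  obtain ⟨f, g, w, hS⟩ := h.exists_shortExact
  refine subsingleton_of_forall_eq 0 fun x => ?_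
  obtain ⟨y, rfl⟩ := Ext.contravariant_sequence_exact₂ hS _ x (Subsingleton.elim _ _)
  rw [Subsingleton.elim y 0, Ext.comp_zero]

theorem HasShortExact.subsingleton_ext_right {A B C : ModuleCat.{u} R} (h : HasShortExact A B C)
    (Y : ModuleCat.{u} R) (i : ℕ) (hA : Subsingleton (Ext A Y i))
    (hB : Subsingleton (Ext B Y (i + 1))) : Subsingleton (Ext C Y (i + 1)) := by
  obtain ⟨f, g, w, hS⟩ := h.exists_shortExact
  refine subsingleton_of_forall_eq 0 fun x => ?_
  obtain ⟨y, rfl⟩ := Ext.contravariant_sequence_exact₃ hS _ x (Subsingleton.elim _ _)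
    (add_comm 1 i)
  rw [Subsingleton.elim y 0, Ext.comp_zero]

/-- Maps out of the first term extend to the second if `Ext¹` of the third term vanishes. -/
theorem exists_comp_eq_of_subsingleton_ext {A B C Y : ModuleCat.{u} R}
    {f : A →ₗ[R] B} {g : B →ₗ[R] C} (hf : Function.Injective f) (hfg : Function.Exact f g)
    (hg : Function.Surjective g) (hY : Subsingleton (Ext C Y 1)) (φ : A →ₗ[R] Y) :
    ∃ ψ : B →ₗ[R] Y, ψ ∘ₗ f = φ := by
  obtain ⟨ψ, hψ⟩ := Ext.contravariant_sequence_exact₁ (moduleShortComplex_shortExact hf hfg hg) _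
    (Ext.mk₀ (ModuleCat.ofHom φ)) (add_zero 1) (Subsingleton.elim _ _)
  obtain ⟨ψ, rfl⟩ := Ext.homEquiv₀.symm.surjective ψ
  refine ⟨ψ.hom, ?_⟩
  have : ModuleCat.ofHom f ≫ ψ = ModuleCat.ofHom φ :=
    Ext.homEquiv₀.symm.injective (by simpa using hψ)
  exact congrArg ModuleCat.Hom.hom this

/-- As `B` is projective, every class in `Ext¹(C, Y)` is the extension class pushed out along some
`φ : A → Y`; it vanishes once `φ` extends to `B`. -/
theorem subsingleton_ext_one_of_exists_comp_eq {A B C Y : ModuleCat.{u} R}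
    {f : A →ₗ[R] B} {g : B →ₗ[R] C} (hf : Function.Injective f) (hfg : Function.Exact f g)
    (hg : Function.Surjective g) (hB : Module.Projective R B)
    (h : ∀ φ : A →ₗ[R] Y, ∃ ψ : B →ₗ[R] Y, ψ ∘ₗ f = φ) : Subsingleton (Ext C Y 1) := by
  have hS := moduleShortComplex_shortExact hf hfg hg
  have : Projective B := (IsProjective.iff_projective (R := R) B).1 hB
  refine subsingleton_of_forall_eq 0 fun x => ?_
  obtain ⟨φ, rfl⟩ := Ext.contravariant_sequence_exact₃ hS _ x (Ext.eq_zero_of_projective _)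
    (add_zero 1)
  obtain ⟨φ, rfl⟩ := Ext.homEquiv₀.symm.surjective φ
  obtain ⟨ψ, hψ⟩ := h φ.hom
  have : φ = ModuleCat.ofHom f ≫ ModuleCat.ofHom ψ := by
    ext x
    exact (LinearMap.congr_fun hψ x).symm
  subst this
  simp only [Ext.homEquiv₀_symm_apply]
  rw [← Ext.mk₀_comp_mk₀]
  exact hS.extClass_comp_assoc _

/-- A short exact sequence with vanishing obstruction `Ext¹(B, A)` splits, so an embedding of `B`
extends to one of the middle term. -/
theorem HasShortExact.prod_of_subsingleton_ext {A D B B' C : ModuleCat.{u} R}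
    (h : HasShortExact A D B) (hext : Subsingleton (Ext B A 1)) (h' : HasShortExact B B' C) :
    HasShortExact D (ModuleCat.of R (A × B')) C := by
  obtain ⟨f, g, hf, hfg, hg⟩ := h
  obtain ⟨f', g', hf', hfg', hg'⟩ := h'
  obtain ⟨r, hr⟩ := exists_comp_eq_of_subsingleton_ext hf hfg hg hext LinearMap.id
  have hr' : ∀ a, r (f a) = a := LinearMap.congr_fun hr
  refine ⟨r.prod (f' ∘ₗ g), g' ∘ₗ LinearMap.snd R A B', ?_, ?_, ?_⟩
  · refine (injective_iff_map_eq_zero _).2 fun x hx => ?_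
    have h1 : r x = 0 := congrArg Prod.fst hx
    have h2 : g x = 0 := hf' (by simpa using congrArg Prod.snd hx)
    obtain ⟨a, rfl⟩ := (hfg x).1 h2
    rw [hr'] at h1
    simp [h1]
  · rintro ⟨a, b'⟩
    constructor
    · intro hb
      obtain ⟨b, rfl⟩ := (hfg' b').1 hb
      obtain ⟨d, rfl⟩ := hg b
      -- Adding `f (a - r d)` corrects the first coordinate to `a` and is invisible to `g`.
      refine ⟨d + f (a - r d), ?_⟩
      ext
      · simp [hr']
      · simp [hfg.apply_apply_eq_zero]
    · rintro ⟨d, hd⟩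
      rw [← hd]
      exact hfg'.apply_apply_eq_zero _
  · intro c
    obtain ⟨b, rfl⟩ := hg' c
    exact ⟨(0, b), rfl⟩

end ShortExactSequences

/-! ### Gorenstein projective modules through cosyzygies -/

section GorensteinProjective

variable {R : Type u} [Ring R]

/-- All `Extⁱ(M, Q)` with `i > 0` and `Q` projective vanish. -/
def ExtVanishesOnProjectives (M : ModuleCat.{u} R) : Prop :=
  ∀ Q : ModuleCat.{u} R, Module.Projective R Q → ∀ i : ℕ, Subsingleton (Ext M Q (i + 1))

theorem subsingleton_ext_of_projective {P : ModuleCat.{u} R} (hP : Module.Projective R P)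
    (Y : ModuleCat.{u} R) (i : ℕ) : Subsingleton (Ext P Y (i + 1)) := by
  have : Projective P := (IsProjective.iff_projective (R := R) P).1 hP
  exact Ext.subsingleton_of_projective _ _ _

theorem ExtVanishesOnProjectives.of_hasShortExact {A B C : ModuleCat.{u} R}
    (h : HasShortExact A B C) (hB : ExtVanishesOnProjectives B)
    (hC : ExtVanishesOnProjectives C) : ExtVanishesOnProjectives A :=
  fun Q hQ i => h.subsingleton_ext_left Q (i + 1) (hB Q hQ i) (hC Q hQ (i + 1))

theorem ExtVanishesOnProjectives.of_projective {P : ModuleCat.{u} R}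
    (hP : Module.Projective R P) : ExtVanishesOnProjectives P :=
  fun Q _ i => subsingleton_ext_of_projective hP Q i

/-- `B` is the cokernel of an embedding of `A` in a projective module, and
`Ext¹(B, Q) = 0` for all projective `Q`. -/
def IsCosyzygy (A B : ModuleCat.{u} R) : Prop :=
  (∃ P : ModuleCat.{u} R, Module.Projective R P ∧ HasShortExact A P B) ∧
    ∀ Q : ModuleCat.{u} R, Module.Projective R Q → Subsingleton (Ext B Q 1)

/-- A doubly infinite sequence of cosyzygies yields Gorenstein projective modules. -/
theorem isGorensteinProjective_of_isCosyzygy (h : ℤ → ModuleCat.{u} R)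
    (hh : ∀ i, IsCosyzygy (h i) (h (i + 1))) : IsGorensteinProjective R (h 1) := by
  choose P hP f g hf hfg hg using fun i => (hh i).1
  -- Splice the short exact sequences: each differential factors as `P i ↠ h (i + 1) ↪ P (i + 1)`,
  -- so the image of `d 0` is `h 1`.
  let d : ∀ i, P i ⟶ P (i + 1) := fun i => ModuleCat.ofHom (f (i + 1) ∘ₗ g i)
  have sq : ∀ i, d i ≫ d (i + 1) = 0 := fun i => by
    ext x
    change f (i + 1 + 1) (g (i + 1) (f (i + 1) (g i x))) = 0
    rw [(hfg (i + 1)).apply_apply_eq_zero, map_zero]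
  have hd : ∀ i, (CochainComplex.of P d sq).d i (i + 1) = d i := CochainComplex.of_d P d
  refine ⟨CochainComplex.of P d sq, hP, ?_, ?_, ?_⟩
  · rintro i _ _ rfl rfl
    rw [hd, hd]
    intro x
    change f (i + 1 + 1) (g (i + 1) x) = 0 ↔ ∃ y, f (i + 1) (g i y) = x
    rw [map_eq_zero_iff _ (hf _), hfg (i + 1) x]
    constructor
    · rintro ⟨z, rfl⟩
      obtain ⟨y, rfl⟩ := hg i z
      exact ⟨y, rfl⟩
    · rintro ⟨y, rfl⟩
      exact ⟨_, rfl⟩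
  · rintro Q hQ i _ _ rfl rfl
    rw [hd, hd]
    intro φ
    change φ ∘ₗ (f (i + 1) ∘ₗ g i) = 0 ↔
      ∃ ψ : P (i + 1 + 1) →ₗ[R] Q, ψ ∘ₗ (f (i + 1 + 1) ∘ₗ g (i + 1)) = φ
    constructor
    · intro h0
      have h1 : ∀ y, φ (f (i + 1) y) = 0 := fun y => by
        obtain ⟨x, rfl⟩ := hg i y
        exact LinearMap.congr_fun h0 x
      have hle : LinearMap.ker (g (i + 1)) ≤ LinearMap.ker φ := by
        intro x hx
        obtain ⟨y, rfl⟩ := (hfg (i + 1) x).1 hx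
        exact h1 y
      -- The cocycle `φ` descends to the cosyzygy `h (i + 2)`; the obstruction to extending it over
      -- `P (i + 2)` lies in `Ext¹(h (i + 3), Q) = 0`.
      let χ : h (i + 1 + 1) →ₗ[R] Q := (LinearMap.ker (g (i + 1))).liftQ φ hle ∘ₗ
        ((g (i + 1)).quotKerEquivOfSurjective (hg (i + 1))).symm.toLinearMap
      have hχ : χ ∘ₗ g (i + 1) = φ := by
        ext x
        have : ((g (i + 1)).quotKerEquivOfSurjective (hg (i + 1))).symm (g (i + 1) x) =
            (LinearMap.ker (g (i + 1))).mkQ x := by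
          rw [LinearEquiv.symm_apply_eq]
          rfl
        simp [χ, this]
      obtain ⟨ψ, hψ⟩ := exists_comp_eq_of_subsingleton_ext (Y := Q) (hf _) (hfg _) (hg (i + 1 + 1))
        ((hh (i + 1 + 1)).2 Q hQ) χ
      exact ⟨ψ, by rw [← LinearMap.comp_assoc, hψ, hχ]⟩
    · rintro ⟨ψ, rfl⟩
      ext x
      simp [(hfg (i + 1)).apply_apply_eq_zero]
  · have h01 : (CochainComplex.of P d sq).d 0 1 = d 0 := hd 0
    rw [h01]
    have hr : LinearMap.range (d 0).hom = LinearMap.range (f (0 + 1)) :=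
      LinearMap.range_comp_of_range_eq_top _ (LinearMap.range_eq_top.2 (hg 0))
    exact ⟨(LinearEquiv.ofInjective (f (0 + 1)) (hf _)).trans (LinearEquiv.ofEq _ _ hr.symm)⟩

theorem IsGorensteinProjective.exists_isCosyzygy {M : ModuleCat.{u} R}
    (hM : IsGorensteinProjective R M) :
    ∃ h : ℤ → ModuleCat.{u} R, (∀ i, IsCosyzygy (h i) (h (i + 1))) ∧
      Nonempty (M ≃ₗ[R] h 1) := by
  obtain ⟨K, hP, hK, hQ, ⟨e⟩⟩ := hM
  -- The index is shifted so that `h i` sits inside `K.X i` as the kernel of the outgoing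
  -- differential, and `h 1` is the image of `K⁰ → K¹`.
  refine ⟨fun i => ModuleCat.of R (LinearMap.range (K.d (i - 1) i).hom), fun i => ?_, ?_⟩
  swap
  · beta_reduce
    rw [show (1 : ℤ) - 1 = 0 from rfl]
    exact ⟨e⟩
  have hi : i - 1 + 1 = i := by ring
  beta_reduce
  rw [show i + 1 - 1 = i by ring]
  have hex : LinearMap.ker (K.d i (i + 1)).hom = LinearMap.range (K.d (i - 1) i).hom :=
    LinearMap.exact_iff.1 (hK _ _ _ hi rfl)
  have hfg : Function.Exact (LinearMap.range (K.d (i - 1) i).hom).subtype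
      (K.d i (i + 1)).hom.rangeRestrict := by
    rw [LinearMap.exact_iff, LinearMap.ker_rangeRestrict, Submodule.range_subtype, hex]
  have hsurj : Function.Surjective (K.d i (i + 1)).hom.rangeRestrict :=
    LinearMap.surjective_rangeRestrict _
  refine ⟨⟨K.X i, hP i, (LinearMap.range (K.d (i - 1) i).hom).subtype,
    (K.d i (i + 1)).hom.rangeRestrict, Subtype.val_injective, hfg, hsurj⟩, fun Q hQp => ?_⟩
  refine subsingleton_ext_one_of_exists_comp_eq
    (A := ModuleCat.of R (LinearMap.range (K.d (i - 1) i).hom))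
    (C := ModuleCat.of R (LinearMap.range (K.d i (i + 1)).hom))
    Subtype.val_injective hfg hsurj (hP i) fun φ => ?_
  have hi' : i - 1 - 1 + 1 = i - 1 := by ring
  -- Precomposed with `Kⁱ⁻¹ ↠ h i`, the map `φ` becomes a cocycle of `Hom(K, Q)`; exactness there
  -- provides the extension to `Kⁱ`.
  obtain ⟨ψ, hψ⟩ := (hQ Q hQp _ _ _ hi' hi (φ ∘ₗ (K.d (i - 1) i).hom.rangeRestrict)).1 (by
    ext x
    have : (K.d (i - 1) i).hom.rangeRestrict ((K.d (i - 1 - 1) (i - 1)).hom x) = 0 :=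
      Subtype.ext ((hK _ _ _ hi' hi).apply_apply_eq_zero x)
    change φ _ = 0
    exact (congrArg φ this).trans (map_zero φ))
  refine ⟨ψ, ?_⟩
  ext ⟨_, x, rfl⟩
  exact LinearMap.congr_fun hψ x

theorem IsGorensteinProjective.exists_cosyzygy {M : ModuleCat.{u} R}
    (hM : IsGorensteinProjective R M) :
    ∃ P C : ModuleCat.{u} R, Module.Projective R P ∧ HasShortExact M P C ∧
      IsGorensteinProjective R C := by
  obtain ⟨h, hh, ⟨e⟩⟩ := hM.exists_isCosyzygy
  obtain ⟨⟨P, hP, hs⟩, -⟩ := hh 1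
  refine ⟨P, _, hP, hs.of_equiv e.symm (.refl R _), ?_⟩
  exact isGorensteinProjective_of_isCosyzygy (fun i => h (i + 1)) fun i => hh (i + 1)

theorem IsGorensteinProjective.extVanishes {M : ModuleCat.{u} R}
    (hM : IsGorensteinProjective R M) : ExtVanishesOnProjectives M := by
  obtain ⟨h, hh, ⟨e⟩⟩ := hM.exists_isCosyzygy
  -- Dimension shifting moves `Extⁱ⁺²(h j, Q)` to `Extⁱ⁺¹(h (j - 1), Q)`, so the induction has to
  -- run over all `j` at once.
  have key : ∀ (i : ℕ) (j : ℤ) (Q : ModuleCat.{u} R), Module.Projective R Q →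
      Subsingleton (Ext (h j) Q (i + 1)) := by
    intro i
    induction i with
    | zero =>
      intro j Q hQ
      have := (hh (j - 1)).2 Q hQ
      rwa [show j - 1 + 1 = j by ring] at this
    | succ i ih =>
      intro j Q hQ
      obtain ⟨⟨P, hP, hs⟩, -⟩ := hh (j - 1)
      have := hs.subsingleton_ext_right Q (i + 1) (ih _ Q hQ) (subsingleton_ext_of_projective hP _ _)
      rwa [show j - 1 + 1 = j by ring] at this
  intro Q hQ i
  have hs : HasShortExact M (h 1) (ModuleCat.of R PUnit.{u + 1}) :=
    ⟨e.toLinearMap, 0, e.injective, (LinearMap.exact_zero_iff_surjective _ _).2 e.surjective,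
      fun _ => ⟨0, Subsingleton.elim _ _⟩⟩
  exact hs.subsingleton_ext_left Q _ (key i 1 Q hQ)
    (subsingleton_ext_of_projective (P := ModuleCat.of R PUnit.{u + 1})
      (inferInstanceAs (Module.Projective R PUnit.{u + 1})) _ _)

/-- A class of modules with vanishing `Extⁱ(-, projective)`, each of which embeds in a projective
module with cokernel in the class, consists of Gorenstein projective modules. -/
theorem isGorensteinProjective_of_forall_exists (X : ModuleCat.{u} R → Prop)
    (hext : ∀ M, X M → ExtVanishesOnProjectives M)
    (hX : ∀ M, X M → ∃ P C : ModuleCat.{u} R, Module.Projective R P ∧ HasShortExact M P C ∧ X C)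
    {M : ModuleCat.{u} R} (hM : X M) : IsGorensteinProjective R M := by
  -- To the right the sequence stays in the class `X`. To the left, syzygies need only the vanishing
  -- of Ext, which they inherit.
  have up : ∀ A : {A : ModuleCat.{u} R // X A}, ∃ B : {A : ModuleCat.{u} R // X A},
      IsCosyzygy A.1 B.1 := fun A => by
    obtain ⟨P, C, hP, hs, hC⟩ := hX A.1 A.2
    exact ⟨⟨C, hC⟩, ⟨P, hP, hs⟩, fun Q hQ => hext C hC Q hQ 0⟩
  have down : ∀ B : {B : ModuleCat.{u} R // ExtVanishesOnProjectives B},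
      ∃ A : {A : ModuleCat.{u} R // ExtVanishesOnProjectives A}, IsCosyzygy A.1 B.1 := fun B => by
    obtain ⟨A, P, hP, hs⟩ := exists_hasShortExact_projective B.1
    exact ⟨⟨A, .of_hasShortExact hs (.of_projective hP) B.2⟩, ⟨P, hP, hs⟩,
      fun Q hQ => B.2 Q hQ 0⟩
  choose s hs using up
  choose t ht using down
  let a : ℕ → ModuleCat.{u} R := fun n => (s^[n] ⟨M, hM⟩).1
  let b : ℕ → ModuleCat.{u} R := fun n => (t^[n] ⟨M, hext M hM⟩).1
  have ha : ∀ n, IsCosyzygy (a n) (a (n + 1)) := fun n => by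
    simp only [a, Function.iterate_succ_apply']
    exact hs _
  have hb : ∀ n, IsCosyzygy (b (n + 1)) (b n) := fun n => by
    simp only [b, Function.iterate_succ_apply']
    exact ht _
  let h : ℤ → ModuleCat.{u} R := fun
    | .ofNat n => a n
    | .negSucc n => b (n + 1)
  have hh : ∀ i, IsCosyzygy (h i) (h (i + 1)) := fun
    | .ofNat n => ha n
    | .negSucc 0 => hb 0
    | .negSucc (n + 1) => hb (n + 1)
  -- `M` stands at index `0` of `h`; the shift brings it to index `1`.
  have := isGorensteinProjective_of_isCosyzygy (fun i => h (i - 1)) fun i => by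
    have := hh (i - 1)
    rwa [show i - 1 + 1 = i + 1 - 1 by ring] at this
  exact this

theorem IsGorensteinProjective.of_projective {P : ModuleCat.{u} R}
    (hP : Module.Projective R P) : IsGorensteinProjective R P := by
  refine isGorensteinProjective_of_forall_exists (fun P => Module.Projective R P)
    (fun P hP => .of_projective hP) (fun P hP => ?_) hP
  exact ⟨P, ModuleCat.of R PUnit.{u + 1}, hP,
    ⟨LinearMap.id, 0, Function.injective_id,
      (LinearMap.exact_zero_iff_surjective _ _).2 Function.surjective_id,
      fun _ => ⟨0, Subsingleton.elim _ _⟩⟩, inferInstanceAs (Module.Projective R PUnit.{u + 1})⟩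

/-- The kernel of a map from a projective module onto a Gorenstein projective one is Gorenstein
projective. -/
theorem IsGorensteinProjective.of_hasShortExact_projective {M P C : ModuleCat.{u} R}
    (h : HasShortExact M P C) (hP : Module.Projective R P) (hC : IsGorensteinProjective R C) :
    IsGorensteinProjective R M := by
  refine isGorensteinProjective_of_forall_exists
    (fun M => ExtVanishesOnProjectives M ∧ ∃ P C : ModuleCat.{u} R, Module.Projective R P ∧
      HasShortExact M P C ∧ IsGorensteinProjective R C) (fun M hM => hM.1) ?_
    ⟨.of_hasShortExact h (.of_projective hP) hC.extVanishes, P, C, hP, h, hC⟩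
  rintro M ⟨-, P, C, hP, h, hC⟩
  exact ⟨P, C, hP, h, hC.extVanishes, hC.exists_cosyzygy⟩

/-- Gorenstein projective modules are closed under extensions. -/
theorem IsGorensteinProjective.of_hasShortExact {A B C : ModuleCat.{u} R}
    (h : HasShortExact A B C) (hA : IsGorensteinProjective R A)
    (hC : IsGorensteinProjective R C) : IsGorensteinProjective R B := by
  refine isGorensteinProjective_of_forall_exists
    (fun B => ∃ A C : ModuleCat.{u} R, HasShortExact A B C ∧ IsGorensteinProjective R A ∧
      IsGorensteinProjective R C) ?_ ?_ ⟨A, C, h, hA, hC⟩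
  · rintro B ⟨A, C, h, hA, hC⟩ Q hQ i
    exact h.subsingleton_ext_middle Q _ (hA.extVanishes Q hQ i) (hC.extVanishes Q hQ i)
  · rintro B ⟨A, C, h, hA, hC⟩
    obtain ⟨P, A', hP, hsA, hA'⟩ := hA.exists_cosyzygy
    obtain ⟨P', C', hP', hsC, hC'⟩ := hC.exists_cosyzygy
    -- A horseshoe argument for cosyzygies: the pushout `D` is an extension of `C` by `P`, split
    -- because `Ext¹(C, P) = 0`, so it embeds in `P × P'`. Then `(P × P') / B` is an extension of
    -- `C'` by `A'`, again in the class.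
    obtain ⟨D, hPD, hBD⟩ := h.exists_pushout hsA
    have hD := hPD.prod_of_subsingleton_ext (hC.extVanishes P hP 0) hsC
    obtain ⟨F, hBF, hF⟩ := hBD.exists_cokernel_comp hD
    exact ⟨_, F, inferInstanceAs (Module.Projective R (P × P')), hBF, A', C', hF, hA', hC'⟩

end GorensteinProjective

/-! ### Gorenstein projective dimension against projective dimension -/

section GorensteinProjectiveDimension

variable {R : Type u} [Ring R]

theorem HasShortExact.hasProjectiveDimensionLT_left {A B C : ModuleCat.{u} R}
    (h : HasShortExact A B C) (n : ℕ) (hB : HasProjectiveDimensionLT B n)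
    (hC : HasProjectiveDimensionLT C (n + 1)) : HasProjectiveDimensionLT A n := by
  obtain ⟨f, g, w, hS⟩ := h.exists_shortExact
  exact hS.hasProjectiveDimensionLT_X₁ n hB hC

theorem HasShortExact.hasProjectiveDimensionLT_right {A B C : ModuleCat.{u} R}
    (h : HasShortExact A B C) (n : ℕ) (hA : HasProjectiveDimensionLT A n)
    (hB : HasProjectiveDimensionLT B (n + 1)) : HasProjectiveDimensionLT C (n + 1) := by
  obtain ⟨f, g, w, hS⟩ := h.exists_shortExact
  exact hS.hasProjectiveDimensionLT_X₃ n hA hB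

theorem hasProjectiveDimensionLE_of_projective {P : ModuleCat.{u} R}
    (hP : Module.Projective R P) (n : ℕ) : HasProjectiveDimensionLE P n := by
  have : Projective P := (IsProjective.iff_projective (R := R) P).1 hP
  exact hasProjectiveDimensionLT_of_ge P 1 _ (by lia)

theorem projective_of_hasProjectiveDimensionLE_zero {P : ModuleCat.{u} R}
    (hP : HasProjectiveDimensionLE P 0) : Module.Projective R P :=
  (IsProjective.iff_projective (R := R) P).2 ((projective_iff_hasProjectiveDimensionLE_zero P).2 hP)

theorem gorensteinProjectiveDimensionLE_of_hasProjectiveDimensionLE :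
    ∀ (n : ℕ) {M : ModuleCat.{u} R}, HasProjectiveDimensionLE M n →
      GorensteinProjectiveDimensionLE R n M
  | 0, _, hM => .of_projective (projective_of_hasProjectiveDimensionLE_zero hM)
  | n + 1, M, hM => by
    obtain ⟨K, P, hP, hs⟩ := exists_hasShortExact_projective M
    have hK : HasProjectiveDimensionLE K n :=
      hs.hasProjectiveDimensionLT_left _ (hasProjectiveDimensionLE_of_projective hP n) hM
    obtain ⟨i, p, hi, hip, hp⟩ := hs
    exact ⟨K, P, i, p, hi, hip, hp, .of_projective hP,
      gorensteinProjectiveDimensionLE_of_hasProjectiveDimensionLE n hK⟩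

/-- A module of finite Gorenstein projective dimension embeds in a module of finite projective
dimension with Gorenstein projective cokernel. -/
theorem GorensteinProjectiveDimensionLE.exists_hull :
    ∀ (n : ℕ) {M : ModuleCat.{u} R}, GorensteinProjectiveDimensionLE R n M →
      ∃ W C : ModuleCat.{u} R, HasShortExact M W C ∧ HasProjectiveDimensionLE W n ∧
        IsGorensteinProjective R C
  | 0, M, hM => by
    obtain ⟨P, C, hP, hs, hC⟩ := IsGorensteinProjective.exists_cosyzygy hM
    exact ⟨P, C, hs, hasProjectiveDimensionLE_of_projective hP 0, hC⟩
  | n + 1, M, hM => by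
    obtain ⟨K, G, i, p, hi, hip, hp, hG, hK⟩ := hM
    obtain ⟨W, C, hs, hW, hC⟩ := GorensteinProjectiveDimensionLE.exists_hull n hK
    have hKGM : HasShortExact K G M := ⟨i, p, hi, hip, hp⟩
    -- The pushout `D` of `G` and `W` over `K` is an extension of `C` by `G`, hence Gorenstein
    -- projective, and `D / W = M`. Embedding `D` in a projective `P` places `M` in `F = P / W`, at
    -- the cost of one more projective dimension.
    obtain ⟨D, hWD, hGD⟩ := hKGM.exists_pushout hs
    obtain ⟨P, D', hP, hsD, hD'⟩ := (IsGorensteinProjective.of_hasShortExact hGD hG hC).exists_cosyzygy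
    obtain ⟨F, hWF, hMF⟩ := hWD.exists_cokernel_comp hsD
    exact ⟨F, D', hMF, hWF.hasProjectiveDimensionLT_right _ hW
      (hasProjectiveDimensionLE_of_projective hP _), hD'⟩

/-- If modules of finite projective dimension have projective dimension at most `k`, then modules
of finite Gorenstein projective dimension have Gorenstein projective dimension at most `k`. -/
theorem GorensteinProjectiveDimensionLE.of_forall_hasProjectiveDimensionLE {k : ℕ}
    (hk : ∀ (W : ModuleCat.{u} R) (m : ℕ), HasProjectiveDimensionLE W m →
      HasProjectiveDimensionLE W k)
    {m : ℕ} {M : ModuleCat.{u} R} (hM : GorensteinProjectiveDimensionLE R m M) :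
    GorensteinProjectiveDimensionLE R k M := by
  obtain ⟨W, C, hs, hW, hC⟩ := GorensteinProjectiveDimensionLE.exists_hull m hM
  have hW' := hk W m hW
  cases k with
  | zero =>
    exact .of_hasShortExact_projective hs (projective_of_hasProjectiveDimensionLE_zero hW') hC
  | succ k =>
    obtain ⟨V, P, hP, hV⟩ := exists_hasShortExact_projective W
    -- `D` is the preimage of `M` in `P`. It is the kernel of `P ↠ C`, hence Gorenstein projective,
    -- and it maps onto `M` with kernel `V`.
    obtain ⟨D, hVD, hD⟩ := hV.exists_kernel_comp hs
    have hVk : HasProjectiveDimensionLE V k :=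
      hV.hasProjectiveDimensionLT_left _ (hasProjectiveDimensionLE_of_projective hP k) hW'
    obtain ⟨i, p, hi, hip, hp⟩ := hVD
    exact ⟨V, D, i, p, hi, hip, hp, .of_hasShortExact_projective hD hP hC,
      gorensteinProjectiveDimensionLE_of_hasProjectiveDimensionLE k hVk⟩

theorem GorensteinProjectiveDimensionLE.subsingleton_ext :
    ∀ (n : ℕ) {M : ModuleCat.{u} R}, GorensteinProjectiveDimensionLE R n M →
      ∀ (Q : ModuleCat.{u} R), Module.Projective R Q → ∀ i : ℕ, n < i → Subsingleton (Ext M Q i)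
  | 0, M, hM, Q, hQ, i, hi => by
    obtain ⟨i, rfl⟩ := Nat.exists_eq_succ_of_ne_zero hi.ne'
    exact IsGorensteinProjective.extVanishes hM Q hQ i
  | n + 1, M, ⟨K, G, i, p, hi, hip, hp, hG, hK⟩, Q, hQ, j, hj => by
    obtain ⟨j, rfl⟩ := Nat.exists_eq_succ_of_ne_zero (Nat.ne_zero_of_lt hj)
    exact HasShortExact.subsingleton_ext_right ⟨i, p, hi, hip, hp⟩ Q j
      (GorensteinProjectiveDimensionLE.subsingleton_ext n hK Q hQ j (by lia))
      (hG.extVanishes Q hQ j)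

/-- The projective dimension of a module is bounded by its Gorenstein projective dimension if it
is finite. -/
theorem HasProjectiveDimensionLE.of_gorensteinProjectiveDimensionLE {n : ℕ} {M : ModuleCat.{u} R}
    (hM : GorensteinProjectiveDimensionLE R n M) {m : ℕ} (hm : HasProjectiveDimensionLE M m) :
    HasProjectiveDimensionLE M n := by
  induction m with
  | zero => exact hasProjectiveDimensionLT_of_ge M 1 _ (by lia)
  | succ m ih =>
    rcases le_or_gt (m + 1) n with h | h
    · exact hasProjectiveDimensionLT_of_ge M (m + 1 + 1) _ (by lia)
    · refine ih ((hasProjectiveDimensionLT_iff M (m + 1)).2 fun i hi Y e => ?_)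
      rcases hi.lt_or_eq with hi | rfl
      · exact e.eq_zero_of_hasProjectiveDimensionLT (m + 1 + 1) (by lia)
      · obtain ⟨K, P, hP, hs⟩ := exists_hasShortExact_projective Y
        obtain ⟨f, g, w, hS⟩ := hs.exists_shortExact
        obtain ⟨x, rfl⟩ := Ext.covariant_sequence_exact₃ M hS e rfl
          (Ext.eq_zero_of_hasProjectiveDimensionLT _ (m + 1 + 1) (by lia))
        have := GorensteinProjectiveDimensionLE.subsingleton_ext n hM P hP _ h
        rw [Subsingleton.elim x 0, Ext.zero_comp]

end GorensteinProjectiveDimension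

/-! ### Tensor products with a cyclic module -/

section CyclicTensor

open TensorProduct

variable {S : Type*} [CommRing S]

/-- With `N ≅ S/I`, right exactness of `P ⊗ -` identifies `P ⊗ N` with `P / I P`. -/
theorem tmul_generator_eq_zero_iff {P N : Type*} [AddCommGroup P] [Module S P]
    [AddCommGroup N] [Module S N] {e : N} (he : ∀ x : N, ∃ s : S, s • e = x) (p : P) :
    p ⊗ₜ[S] e = 0 ↔ p ∈ LinearMap.ker (LinearMap.toSpanSingleton S N e) • (⊤ : Submodule S P) := by
  let q := LinearMap.toSpanSingleton S N e
  have hq : Function.Surjective q := fun x => he x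
  have hex := lTensor_exact P (LinearMap.exact_subtype_ker_map q) hq
  constructor
  · intro h
    obtain ⟨z, hz⟩ := (hex (p ⊗ₜ[S] (1 : S))).1 (by simpa [q] using h)
    have key : ∀ z : P ⊗[S] LinearMap.ker q,
        TensorProduct.rid S P ((LinearMap.ker q).subtype.lTensor P z) ∈
          LinearMap.ker q • (⊤ : Submodule S P) := fun z => by
      induction z with
      | zero => simp
      | add x y hx hy => rw [map_add, map_add]; exact add_mem hx hy
      | tmul x y =>
        simp only [LinearMap.lTensor_tmul, TensorProduct.rid_tmul]
        exact Submodule.smul_mem_smul y.2 trivial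
    have := key z
    rw [hz] at this
    simpa using this
  · intro h
    refine Submodule.smul_induction_on h (fun s hs x _ => ?_) fun x y hx hy => ?_
    · have hs' : s • e = 0 := hs
      rw [TensorProduct.smul_tmul, hs', TensorProduct.tmul_zero]
    · rw [TensorProduct.add_tmul, hx, hy, add_zero]

theorem exists_tmul_generator_eq {P N : Type*} [AddCommGroup P] [Module S P]
    [AddCommGroup N] [Module S N] {e : N} (he : ∀ x : N, ∃ s : S, s • e = x) (z : P ⊗[S] N) :
    ∃ p : P, p ⊗ₜ[S] e = z := by
  induction z with
  | zero => exact ⟨0, TensorProduct.zero_tmul _ _⟩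
  | add x y hx hy =>
    obtain ⟨a, rfl⟩ := hx
    obtain ⟨b, rfl⟩ := hy
    exact ⟨a + b, TensorProduct.add_tmul _ _ _⟩
  | tmul x y =>
    obtain ⟨s, rfl⟩ := he y
    exact ⟨s • x, TensorProduct.smul_tmul _ _ _⟩

theorem one_tmul_eq_zero_iff {R : Type*} [CommRing R] [Algebra S R]
    (hS : Function.Surjective (algebraMap S R)) {P : Type*} [AddCommGroup P] [Module S P] (p : P) :
    (1 : R) ⊗ₜ[S] p = 0 ↔ p ∈ RingHom.ker (algebraMap S R) • (⊤ : Submodule S P) := by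
  have he : ∀ x : R, ∃ s : S, s • (1 : R) = x := fun x => by
    obtain ⟨s, rfl⟩ := hS x
    exact ⟨s, (Algebra.algebraMap_eq_smul_one s).symm⟩
  have hk : RingHom.ker (algebraMap S R) =
      LinearMap.ker (LinearMap.toSpanSingleton S R (1 : R)) := by
    ext s
    simp [RingHom.mem_ker, Algebra.algebraMap_eq_smul_one]
  rw [hk, ← tmul_generator_eq_zero_iff he p, ← (TensorProduct.comm S R P).map_eq_zero_iff,
    TensorProduct.comm_tmul]

end CyclicTensor

/-! ### Vanishing of Tor as a purity condition on syzygies -/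

section Syzygies

open TensorProduct

variable {S : Type u} [CommRing S]

/-- The syzygies of a module `M`, in a projective resolution, satisfy `K ∩ I P = I K` beyond degree
`n` if `Torᵢ(M, S/I) = 0` for `i > n`, where `S/I` is given as a cyclic module `N`. -/
theorem exists_syzygies {N : ModuleCat.{u} S} {e : N} (he : ∀ x : N, ∃ s : S, s • e = x)
    (M : ModuleCat.{u} S) (n : ℕ)
    (htor : ∀ i : ℕ, n < i → Limits.IsZero (((Tor' (ModuleCat.{u} S) i).obj M).obj N)) :
    ∃ (K P : ℕ → ModuleCat.{u} S) (ι : ∀ j, K (j + 1) →ₗ[S] P j) (π : ∀ j, P j →ₗ[S] K j),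
      Nonempty (K 0 ≃ₗ[S] M) ∧ (∀ j, Module.Projective S (P j)) ∧
      (∀ j, Function.Injective (ι j)) ∧ (∀ j, Function.Exact (ι j) (π j)) ∧
      (∀ j, Function.Surjective (π j)) ∧
      ∀ j, n ≤ j → ∀ x, ι j x ∈ LinearMap.ker (LinearMap.toSpanSingleton S N e) •
        (⊤ : Submodule S (P j)) →
        x ∈ LinearMap.ker (LinearMap.toSpanSingleton S N e) • (⊤ : Submodule S (K (j + 1))) := by
  let P : ProjectiveResolution M := projectiveResolution M
  let d : ∀ j, P.complex.X (j + 1) →ₗ[S] P.complex.X j := fun j => (P.complex.d (j + 1) j).hom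
  have hd : ∀ j, Function.Exact (d (j + 1)) (d j) := fun j =>
    (ShortComplex.ShortExact.moduleCat_exact_iff_function_exact _).1 (P.exact_succ j)
  have hFd : ∀ j, n ≤ j → Function.Exact ((d (j + 1)).rTensor N) ((d j).rTensor N) := by
    intro j hj
    -- Exactness at `Pⱼ₊₁ ⊗ N` is the vanishing of `Torⱼ₊₁`, so `j ≥ n` is already enough.
    let F := (MonoidalCategory.tensoringRight (ModuleCat.{u} S)).obj N
    have hz : Limits.IsZero ((F.leftDerived (j + 1)).obj M) := htor (j + 1) (by lia)
    have hz' := hz.of_iso (P.isoLeftDerivedObj F (j + 1)).symm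
    have hex := (HomologicalComplex.exactAt_iff_isZero_homology _ _).2 hz'
    rw [HomologicalComplex.exactAt_iff' _ (j + 2) (j + 1) j (by simp only [ChainComplex.prev]; rfl)
      (by simp)] at hex
    exact (ShortComplex.ShortExact.moduleCat_exact_iff_function_exact _).1 hex
  have hle : ∀ j, LinearMap.range (d (j + 1)) ≤ LinearMap.ker (d j) := fun j =>
    (LinearMap.exact_iff.1 (hd j)).ge
  -- The syzygies are taken as cokernels of the differentials; exactness of the resolution makes
  -- `Kⱼ₊₁ → Pⱼ` injective.
  refine ⟨fun j => ModuleCat.of S (P.complex.X j ⧸ LinearMap.range (d j)), fun j => P.complex.X j,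
    fun j => (LinearMap.range (d (j + 1))).liftQ (d j) (hle j),
    fun j => (LinearMap.range (d j)).mkQ, ?_, fun j => ?_, fun j => ?_, fun j => ?_,
    fun j => Submodule.mkQ_surjective _, fun j hj x => ?_⟩
  · let π₀ : P.complex.X 0 →ₗ[S] M := (P.π.f 0).hom
    have hex : Function.Exact (d 0) π₀ :=
      (ShortComplex.ShortExact.moduleCat_exact_iff_function_exact _).1 P.exact₀
    have hsurj : Function.Surjective π₀ := (ModuleCat.epi_iff_surjective (P.π.f 0)).1 inferInstance
    exact ⟨hex.linearEquivOfSurjective hsurj⟩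
  · exact (IsProjective.iff_projective (R := S) (P.complex.X j)).2 (P.projective j)
  · rw [← LinearMap.ker_eq_bot, Submodule.ker_liftQ_eq_bot]
    exact (LinearMap.exact_iff.1 (hd j)).le
  · rw [LinearMap.exact_iff, Submodule.ker_mkQ, Submodule.range_liftQ]
  · obtain ⟨y, rfl⟩ := Submodule.mkQ_surjective _ x
    intro hx
    -- A representative `y` of `x` gives a cycle `y ⊗ e`, hence a boundary `d w ⊗ e`. Thus `y - d w`
    -- lies in `I Pⱼ₊₁`, and it still represents `x`.
    have h0 : d j y ⊗ₜ[S] e = 0 := (tmul_generator_eq_zero_iff he _).2 hx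
    obtain ⟨z, hz⟩ := (hFd j hj (y ⊗ₜ[S] e)).1 h0
    obtain ⟨w, rfl⟩ := exists_tmul_generator_eq he z
    have hyw : (y - d (j + 1) w) ⊗ₜ[S] e = 0 := by
      rw [TensorProduct.sub_tmul, sub_eq_zero]
      exact hz.symm
    have hmem := (tmul_generator_eq_zero_iff he _).1 hyw
    have hmap := Submodule.mem_map_of_mem (f := (LinearMap.range (d (j + 1))).mkQ) hmem
    rw [Submodule.map_smul'', map_sub] at hmap
    have hw : (LinearMap.range (d (j + 1))).mkQ (d (j + 1) w) = 0 :=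
      (Submodule.Quotient.mk_eq_zero _).2 ⟨w, rfl⟩
    rw [hw, sub_zero] at hmap
    exact Submodule.smul_mono le_rfl le_top hmap

end Syzygies

/-! ### Projective dimension read off from syzygies -/

section SyzygyDimension

variable {R : Type u} [Ring R] {K P : ℕ → ModuleCat.{u} R}

theorem hasProjectiveDimensionLE_syzygy (hP : ∀ j, Module.Projective R (P j))
    (hs : ∀ j, HasShortExact (K (j + 1)) (P j) (K j)) (j k : ℕ)
    (h : HasProjectiveDimensionLE (K 0) (j + k)) : HasProjectiveDimensionLE (K j) k := by
  induction j generalizing k with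
  | zero => rwa [zero_add] at h
  | succ j ih =>
    exact (hs j).hasProjectiveDimensionLT_left _ (hasProjectiveDimensionLE_of_projective (hP j) k)
      (ih (k + 1) (by rwa [show j + (k + 1) = j + 1 + k by lia]))

theorem hasProjectiveDimensionLE_of_projective_syzygy (hP : ∀ j, Module.Projective R (P j))
    (hs : ∀ j, HasShortExact (K (j + 1)) (P j) (K j)) (j : ℕ)
    (hj : Module.Projective R (K j)) : HasProjectiveDimensionLE (K 0) j := by
  have key : ∀ i, i ≤ j → HasProjectiveDimensionLE (K (j - i)) i := by
    intro i
    induction i with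
    | zero => exact fun _ => hasProjectiveDimensionLE_of_projective hj 0
    | succ i ih =>
      intro hi
      have h1 := hs (j - (i + 1))
      rw [show j - (i + 1) + 1 = j - i by lia] at h1
      exact h1.hasProjectiveDimensionLT_right _ (ih (by lia))
        (hasProjectiveDimensionLE_of_projective (hP _) _)
  simpa using key j le_rfl

end SyzygyDimension

/-! ### Descent along a split surjection with square-zero kernel -/

section ChangeOfRings

open TensorProduct

variable {S R : Type u} [CommRing S] [CommRing R] [Algebra S R]

/-- Only injectivity on the left is at stake. Every element of `R ⊗ K` is some `1 ⊗ k`, and it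
vanishes exactly when `k ∈ I K`, which is what purity detects. -/
theorem hasShortExact_baseChange (hS : Function.Surjective (algebraMap S R))
    {K P L : ModuleCat.{u} S} {f : K →ₗ[S] P} {g : P →ₗ[S] L} (hfg : Function.Exact f g)
    (hg : Function.Surjective g)
    (hpure : ∀ x, f x ∈ RingHom.ker (algebraMap S R) • (⊤ : Submodule S P) →
      x ∈ RingHom.ker (algebraMap S R) • (⊤ : Submodule S K)) :
    HasShortExact (ModuleCat.of R (R ⊗[S] K)) (ModuleCat.of R (R ⊗[S] P))
      (ModuleCat.of R (R ⊗[S] L)) := by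
  refine ⟨f.baseChange R, g.baseChange R, ?_, lTensor_exact R hfg hg,
    LinearMap.lTensor_surjective R hg⟩
  refine (injective_iff_map_eq_zero _).2 fun z hz => ?_
  obtain ⟨k, rfl⟩ := TensorProduct.mk_surjective S K R hS z
  exact (one_tmul_eq_zero_iff hS k).2 (hpure k ((one_tmul_eq_zero_iff hS (f k)).1 hz))

/-- Let `S → R` be a split surjection with square-zero kernel `I`. A module `L` with a presentation
`0 → K → P → L → 0`, `P` projective and `K ∩ I P = I K`, is projective over `S` if `R ⊗ L` is
projective over `R`. -/
theorem projective_of_projective_baseChange [Algebra R S] [IsScalarTower R S R]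
    (hI : RingHom.ker (algebraMap S R) * RingHom.ker (algebraMap S R) = ⊥)
    {K P L : Type u} [AddCommGroup K] [Module S K] [AddCommGroup P] [Module S P]
    [AddCommGroup L] [Module S L] {f : K →ₗ[S] P} {g : P →ₗ[S] L} (hP : Module.Projective S P)
    (hfg : Function.Exact f g) (hg : Function.Surjective g)
    (hpure : ∀ x, f x ∈ RingHom.ker (algebraMap S R) • (⊤ : Submodule S P) →
      x ∈ RingHom.ker (algebraMap S R) • (⊤ : Submodule S K))
    (hL : Module.Projective R (R ⊗[S] L)) : Module.Projective S L := by
  set I := RingHom.ker (algebraMap S R) with hIdef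
  have hsplit : ∀ r : R, algebraMap S R (algebraMap R S r) = r := fun r => by
    rw [← IsScalarTower.algebraMap_apply R S R]
    rfl
  have hS : Function.Surjective (algebraMap S R) := fun r => ⟨_, hsplit r⟩
  have hII : ∀ (V : Type u) [AddCommGroup V] [Module S V] (W : Submodule S V),
      W ≤ I • ⊤ → I • W ≤ ⊥ := fun V _ _ W hW => by
    refine (Submodule.smul_mono (le_refl I) hW).trans ?_
    rw [← Submodule.mul_smul, hI, Submodule.bot_smul]
  -- The candidate for `L`: it is projective over `S` and has the same reduction modulo `I`. The
  -- goal is to make a lift `π : P' → L` bijective.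
  let P' := S ⊗[R] (R ⊗[S] L)
  let m : L →ₗ[S] R ⊗[S] L := TensorProduct.mk S R L 1
  have hm : Function.Surjective m := TensorProduct.mk_surjective S L R hS
  let β : P' →ₗ[S] R ⊗[S] L := LinearMap.liftBaseChange S (LinearMap.id : R ⊗[S] L →ₗ[R] _)
  have hβ : Function.Surjective β := fun q => ⟨1 ⊗ₜ q,
    (LinearMap.liftBaseChange_tmul ..).trans (one_smul S q)⟩
  have hβker : ∀ z : P', β z = 0 → z ∈ I • (⊤ : Submodule S P') := by
    have key : ∀ z : P', z - (1 : S) ⊗ₜ[R] β z ∈ I • (⊤ : Submodule S P') := fun z => by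
      induction z using TensorProduct.induction_on with
      | zero => simp
      | add x y hx hy =>
        rw [map_add, TensorProduct.tmul_add, add_sub_add_comm]
        exact add_mem hx hy
      | tmul s q =>
        have h1 : β (s ⊗ₜ q) = algebraMap S R s • q :=
          (LinearMap.liftBaseChange_tmul ..).trans (algebraMap_smul R s q).symm
        rw [h1, ← TensorProduct.smul_tmul, ← TensorProduct.sub_tmul]
        have h2 : (s - algebraMap S R s • (1 : S)) ⊗ₜ[R] q =
            (s - algebraMap S R s • (1 : S)) • ((1 : S) ⊗ₜ[R] q) := by
          rw [TensorProduct.smul_tmul', smul_eq_mul, mul_one]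
        rw [h2]
        refine Submodule.smul_mem_smul ?_ trivial
        rw [hIdef, RingHom.mem_ker, map_sub, ← Algebra.algebraMap_eq_smul_one, hsplit, sub_self]
    intro z hz
    simpa [hz] using key z
  have hP' : Module.Projective S P' := inferInstance
  obtain ⟨π, hπ⟩ := Module.projective_lifting_property m β hm
  have hπ' : ∀ z, (1 : R) ⊗ₜ[S] π z = β z := LinearMap.congr_fun hπ
  -- Nakayama for a nilpotent ideal: `L = im π + I L` and `I² = 0` give `I L ⊆ im π`.
  have hπsurj : Function.Surjective π := by
    have htop : (⊤ : Submodule S L) ≤ LinearMap.range π ⊔ I • ⊤ := fun l _ => by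
      obtain ⟨z, hz⟩ := hβ (1 ⊗ₜ l)
      have : l - π z ∈ I • (⊤ : Submodule S L) := by
        rw [← one_tmul_eq_zero_iff hS, TensorProduct.tmul_sub, hπ', hz, sub_self]
      rw [← add_sub_cancel (π z) l]
      exact Submodule.add_mem_sup ⟨z, rfl⟩ this
    have hIL : I • (⊤ : Submodule S L) ≤ LinearMap.range π := by
      refine (Submodule.smul_mono (le_refl I) htop).trans ?_
      rw [Submodule.smul_sup]
      exact sup_le Submodule.smul_le_right ((hII L _ le_rfl).trans bot_le)
    exact LinearMap.range_eq_top.1 (top_le_iff.1 (htop.trans (sup_le le_rfl hIL)))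
  have hkerle : LinearMap.ker π ≤ I • ⊤ := fun c hc => by
    refine hβker c ?_
    rw [← hπ', LinearMap.mem_ker.1 hc, TensorProduct.tmul_zero]
  obtain ⟨ψ, hψ⟩ := Module.projective_lifting_property g π hg
  have hψ' : ∀ z, g (ψ z) = π z := LinearMap.congr_fun hψ
  let χ : K × P' →ₗ[S] P := f.coprod ψ
  have hχ : Function.Surjective χ := fun p => by
    obtain ⟨z, hz⟩ := hπsurj (g p)
    obtain ⟨k, hk⟩ := (hfg (p - ψ z)).1 (by rw [map_sub, hψ', hz, sub_self])
    exact ⟨(k, z), by simp [χ, hk]⟩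
  obtain ⟨σ, hσ⟩ := Module.projective_lifting_property χ LinearMap.id hχ
  -- `id - σ χ` projects onto `ker χ`, which consists of pairs whose second entry lies in `ker π`;
  -- hence `ρ` takes values in `ker π ⊆ I P'`.
  let ρ : K × P' →ₗ[S] P' := LinearMap.snd S K P' ∘ₗ (LinearMap.id - σ ∘ₗ χ)
  have hρ : LinearMap.range ρ ≤ LinearMap.ker π := by
    rintro _ ⟨x, rfl⟩
    have h0 : χ (x - σ (χ x)) = 0 := by
      have := LinearMap.congr_fun hσ (χ x)
      simp only [LinearMap.comp_apply, LinearMap.id_apply] at this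
      rw [map_sub, this, sub_self]
    have h1 : f (x - σ (χ x)).1 + ψ (x - σ (χ x)).2 = 0 := h0
    have h2 := congrArg g h1
    rw [map_add, hfg.apply_apply_eq_zero, zero_add, map_zero, hψ'] at h2
    exact h2
  have hπinj : Function.Injective π := by
    refine (injective_iff_map_eq_zero _).2 fun c hc => ?_
    have hcI : c ∈ I • (⊤ : Submodule S P') := hkerle hc
    obtain ⟨k, hk⟩ := (hfg (ψ c)).1 (by rw [hψ', hc])
    have hkI : k ∈ I • (⊤ : Submodule S K) := by
      refine hpure k ?_
      rw [hk]
      have := Submodule.mem_map_of_mem (f := ψ) hcI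
      rw [Submodule.map_smul''] at this
      exact Submodule.smul_mono le_rfl le_top this
    -- For `c ∈ ker π`, purity puts `(-k, c)` in `I (K × P')`. As `ρ` sends it to `c`, this forces
    -- `c ∈ I · ker π ⊆ I² P' = 0`.
    have hmem : ((-k, c) : K × P') ∈ I • (⊤ : Submodule S (K × P')) := by
      have h1 := Submodule.mem_map_of_mem (f := LinearMap.inl S K P') (neg_mem hkI)
      have h2 := Submodule.mem_map_of_mem (f := LinearMap.inr S K P') hcI
      rw [Submodule.map_smul''] at h1 h2
      have h3 := add_mem (Submodule.smul_mono (le_refl I) le_top h1)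
        (Submodule.smul_mono (le_refl I) le_top h2)
      simpa using h3
    have hρc : ρ (-k, c) = c := by
      have : χ (-k, c) = 0 := by simp [χ, hk]
      simp [ρ, this]
    have := Submodule.mem_map_of_mem (f := ρ) hmem
    rw [Submodule.map_smul'', Submodule.map_top, hρc] at this
    exact (Submodule.mem_bot S).1 (hII P' _ (hρ.trans hkerle) this)
  exact Module.Projective.of_equiv (LinearEquiv.ofBijective π ⟨hπinj, hπsurj⟩)

/-- Let `S → R` be a split surjection with square-zero kernel. If modules of finite projective
dimension over `R` have projective dimension at most `d`, and `Torᵢ(M, R) = 0` for `i > n`, then the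
`S`-module `M` has projective dimension at most `n + d` if it is finite. -/
theorem hasProjectiveDimensionLE_of_isZero_tor [Algebra R S] [IsScalarTower R S R]
    (hI : RingHom.ker (algebraMap S R) * RingHom.ker (algebraMap S R) = ⊥) {d : ℕ}
    (hd : ∀ (N : ModuleCat.{u} R) (m : ℕ), HasProjectiveDimensionLE N m →
      HasProjectiveDimensionLE N d)
    (M : ModuleCat.{u} S) {m : ℕ} (hm : HasProjectiveDimensionLE M m) (n : ℕ)
    (htor : ∀ i : ℕ, n < i →
      Limits.IsZero (((Tor' (ModuleCat.{u} S) i).obj M).obj (ModuleCat.of S R))) :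
    HasProjectiveDimensionLE M (n + d) := by
  have hS : Function.Surjective (algebraMap S R) := fun r => ⟨algebraMap R S r, by
    rw [← IsScalarTower.algebraMap_apply R S R]
    rfl⟩
  have he : ∀ x : ModuleCat.of S R, ∃ s : S, s • (1 : R) = x := fun x => by
    obtain ⟨s, hs⟩ := hS x
    exact ⟨s, (Algebra.algebraMap_eq_smul_one s).symm.trans hs⟩
  have hk : LinearMap.ker (LinearMap.toSpanSingleton S (ModuleCat.of S R) (1 : R)) =
      RingHom.ker (algebraMap S R) := by
    ext s
    rw [RingHom.mem_ker, Algebra.algebraMap_eq_smul_one]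
    rfl
  obtain ⟨K, P, ι, π, ⟨e⟩, hP, hι, hex, hπ, hpure⟩ := exists_syzygies he M n htor
  rw [hk] at hpure
  have hs : ∀ j, HasShortExact (K (j + 1)) (P j) (K j) := fun j => ⟨ι j, π j, hι j, hex j, hπ j⟩
  have hsR : ∀ j, n ≤ j → HasShortExact (ModuleCat.of R (R ⊗[S] K (j + 1)))
      (ModuleCat.of R (R ⊗[S] P j)) (ModuleCat.of R (R ⊗[S] K j)) := fun j hj =>
    hasShortExact_baseChange hS (hex j) (hπ j) (hpure j hj)
  have hPR : ∀ j, Module.Projective R (ModuleCat.of R (R ⊗[S] P j)) := fun j =>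
    have := hP j
    inferInstanceAs (Module.Projective R (R ⊗[S] P j))
  have hK0 : HasProjectiveDimensionLE (K 0) m := hasProjectiveDimensionLT_of_iso e.symm.toModuleIso _
  -- Padding `m` to `n + m` makes `K (n + m)` projective, at or beyond the degree `n` where base
  -- change is exact.
  have hm' : HasProjectiveDimensionLE (K 0) (n + m) :=
    hasProjectiveDimensionLT_of_ge (K 0) (m + 1) _ (by lia)
  have hKm := projective_of_hasProjectiveDimensionLE_zero
    (hasProjectiveDimensionLE_syzygy hP hs (n + m) 0 hm')
  -- The sequences from degree `n` to `n + m` bound the dimension of `R ⊗ Kₙ` by `m`; `hd` then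
  -- improves `m` to `d`.
  have hR0 : HasProjectiveDimensionLE (ModuleCat.of R (R ⊗[S] K (n + 0))) d :=
    hd _ m (hasProjectiveDimensionLE_of_projective_syzygy
      (K := fun j => ModuleCat.of R (R ⊗[S] K (n + j))) (fun j => hPR (n + j))
      (fun j => hsR (n + j) (by lia)) m (inferInstanceAs (Module.Projective R (R ⊗[S] K (n + m)))))
  have hRd := projective_of_hasProjectiveDimensionLE_zero
    (hasProjectiveDimensionLE_syzygy (K := fun j => ModuleCat.of R (R ⊗[S] K (n + j)))
      (fun j => hPR (n + j)) (fun j => hsR (n + j) (by lia)) d 0 hR0)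
  have hKd : Module.Projective S (K (n + d)) :=
    projective_of_projective_baseChange hI (hP (n + d)) (hex (n + d)) (hπ (n + d))
      (hpure (n + d) (by lia)) hRd
  have := hasProjectiveDimensionLE_of_projective_syzygy hP hs (n + d) hKd
  exact hasProjectiveDimensionLT_of_iso e.toModuleIso _

end ChangeOfRings

/-! ### The bound for the trivial extension -/

theorem exists_gorensteinProjectiveDimensionLE {A : Type u} [Ring A] {d : ℕ}
    (h : gorensteinGlobalDimension A ≤ d) (M : ModuleCat.{u} A) :
    ∃ k ≤ d, GorensteinProjectiveDimensionLE A k M := by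
  -- A strict bound on the infimum produces a witness, hence `d + 1` in place of `d`.
  have h1 : gorensteinProjectiveDimension A M < ((d + 1 : ℕ) : ℕ∞) :=
    ((le_iSup (gorensteinProjectiveDimension A) M).trans h).trans_lt
      (by exact_mod_cast Nat.lt_succ_self d)
  simp only [gorensteinProjectiveDimension, iInf_lt_iff] at h1
  obtain ⟨k, hk, hkd⟩ := h1
  exact ⟨k, Nat.lt_succ_iff.1 (by exact_mod_cast hkd), hk⟩

theorem mainTheorem3 {R E : Type u} [CommRing R] [AddCommGroup E] [Module R E]
    [Module Rᵐᵒᵖ E] [IsCentralScalar R E] (n : ℕ∞)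
    (hfin : gorensteinGlobalDimension (TrivSqZeroExt R E) < ⊤)
    (htor : ∀ M : ModuleCat.{u} (TrivSqZeroExt R E),
      CategoryTheory.projectiveDimension M < ⊤ →
      ∀ i : ℕ, n < (i : ℕ∞) →
        CategoryTheory.Limits.IsZero
          (((CategoryTheory.Tor' (ModuleCat.{u} (TrivSqZeroExt R E)) i).obj M).obj
            (baseAsModule R E))) :
    gorensteinGlobalDimension (TrivSqZeroExt R E) ≤ gorensteinGlobalDimension R + n := by
  obtain ⟨m, hm⟩ := ENat.ne_top_iff_exists.1 hfin.ne
  induction n using ENat.recTopCoe with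
  | top => simp
  | coe n =>
  rcases eq_or_ne (gorensteinGlobalDimension R) ⊤ with hR | hR
  · simp [hR]
  obtain ⟨d, hd⟩ := ENat.ne_top_iff_exists.1 hR
  -- The algebra structure is the one given by `ε`, so that `R` as a module over it agrees with
  -- `baseAsModule R E`.
  let _ : Algebra (TrivSqZeroExt R E) R := (TrivSqZeroExt.fstHom R R E).toRingHom.toAlgebra
  have halg : ∀ s : TrivSqZeroExt R E, algebraMap (TrivSqZeroExt R E) R s = s.fst := fun _ => rfl
  have : IsScalarTower R (TrivSqZeroExt R E) R := ⟨fun r s x => by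
    change (r • s).fst * x = r * (s.fst * x)
    rw [TrivSqZeroExt.fst_smul, smul_eq_mul, mul_assoc]⟩
  have hI : RingHom.ker (algebraMap (TrivSqZeroExt R E) R) *
      RingHom.ker (algebraMap (TrivSqZeroExt R E) R) = ⊥ := by
    refine le_bot_iff.1 (Ideal.mul_le.2 fun a ha b hb => ?_)
    rw [RingHom.mem_ker, halg] at ha hb
    rw [Ideal.mem_bot]
    ext <;> simp [ha, hb]
  have hdR : ∀ (N : ModuleCat.{u} R) (k : ℕ), HasProjectiveDimensionLE N k →
      HasProjectiveDimensionLE N d := fun N k hk => by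
    obtain ⟨l, hl, hN⟩ := exists_gorensteinProjectiveDimensionLE hd.ge N
    have := HasProjectiveDimensionLE.of_gorensteinProjectiveDimensionLE hN hk
    exact hasProjectiveDimensionLT_of_ge N (l + 1) _ (by lia)
  have hdS : ∀ (W : ModuleCat.{u} (TrivSqZeroExt R E)) (k : ℕ), HasProjectiveDimensionLE W k →
      HasProjectiveDimensionLE W (n + d) := fun W k hk =>
    hasProjectiveDimensionLE_of_isZero_tor hI hdR W hk n fun i hi =>
      htor W (lt_top_iff_ne_top.2 ((projectiveDimension_ne_top_iff W).2 ⟨k, hk⟩)) i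
        (by exact_mod_cast hi)
  rw [← hd]
  refine iSup_le fun M => ?_
  -- Only the finiteness of `Gpd M` is used; the a priori bound `m` is discarded.
  obtain ⟨k, -, hk⟩ := exists_gorensteinProjectiveDimensionLE hm.ge M
  have hM := GorensteinProjectiveDimensionLE.of_forall_hasProjectiveDimensionLE hdS hk
  refine (iInf₂_le (n + d) hM).trans ?_
  push_cast
  rw [add_comm]
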